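/- **Theorem (Signaling potential).** Let $n\ge 1$, let $\Sigma_m,\Sigma_w\in\mathbb R^{n\times n}$ be symmetric positive definite, $a>0$, $b\in\mathbb R^n$, $\rho>0$, and let $m\sim\mathcal N(0,\Sigma_m)$ and $w\sim\mathcal N(0,\Sigma_w)$ be independent. An encoder policy is a Borel map $\gamma^e:\mathbb R^n\to\mathbb R^n$ and a decoder policy is a Borel map $\gamma^d:\mathbb R^n\to\mathbb R^n$; put $x=\gamma^e(m)$, $y=x+w$, $u=\gamma^d(y)$. With $A=aI$, the costs, valued in $[0,\infty]$, are $$J^d(\gamma^e,\gamma^d)=\mathbb E\|m-u\|^2,\qquad J^e(\gamma^e,\gamma^d)=\mathbb E\big[\|Am-b-u\|^2+\rho\|x\|^2\big].$$ A decoder policy is a best response to $\gamma^e$ if it minimizes $J^d(\gamma^e,\cdot)$. A pair $(\gamma^e,\gamma^d)$ is a Stackelberg equilibrium if $\gamma^d$ is a best response to $\gamma^e$ and $J^e(\gamma^e,\gamma^d)\le J^e(\tilde\gamma^e,\tilde\gamma^d)$ for every encoder policy $\tilde\gamma^e$ and every best response $\tilde\gamma^d$ to $\tilde\gamma^e$.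 It is non-informative if $u=\mathbb E[m]$ almost surely, and informative if $m$ and $x$ are not independent. The cost kernel $V=I-(A+A^\top)$ equals $(1-2a)I$, and the following hold, where $|\cdot|$ denotes the determinant. 1. If $a\le\frac12$, then the pair $\gamma^e\equiv0$, $\gamma^d\equiv0$ is a Stackelberg equilibrium, and it is the only one up to almost sure equality: every Stackelberg equilibrium satisfies $x=0$ and $u=0$ almost surely. In particular, every Stackelberg equilibrium is non-informative and not informative. 2. If $a>\frac12$, put, for $P\ge0$, $$f(P)=(1-2a)\Big[\operatorname{Tr}\Sigma_m-\frac{n^2|\Sigma_m|^{1/n}|\Sigma_w|^{1/n}}{P+\operatorname{Tr}\Sigma_w}\Big]+\rho P+a^2\operatorname{Tr}\Sigma_m+\|b\|^2 .$$ Then $f$ is a lower bound on the encoder's cost: $J^e(\gamma^e,\gamma^d)\ge f(P)$ for every encoder policy $\gamma^e$ of finite power $P=\mathbb E\|x\|^2$ and every best response $\gamma^d$ to it. Moreover, $f$ attains its minimum over $[0,\infty)$ at some $P>0$ if and only if $$\rho<(2a-1)\,\frac{n^2|\Sigma_m|^{1/n}|\Sigma_w|^{1/n}}{(\operatorname{Tr}\Sigma_w)^2},$$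 and this condition is also equivalent to $f(P)<f(0)$ for some $P>0$. -/

import Mathlib

open MeasureTheory ProbabilityTheory
open scoped ENNReal

namespace GaussianSignaling

noncomputable section

/-- The space `ℝⁿ` with its Euclidean norm. -/
abbrev Vec (n : ℕ) : Type := EuclideanSpace ℝ (Fin n)

/-- The joint law of the source `m ∼ N(0, Σm)` and the channel noise `w ∼ N(0, Σw)`, which are
independent. A point `p` of the sample space is the pair `(m, w) = (p.1, p.2)`. -/
def sourceNoiseLaw {n : ℕ} (Sm Sw : Matrix (Fin n) (Fin n) ℝ) : Measure (Vec n × Vec n) :=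
  (multivariateGaussian 0 Sm).prod (multivariateGaussian 0 Sw)

/-- The transmitted signal `x = γᵉ(m)`. -/
def signal {n : ℕ} (ge : Vec n → Vec n) (p : Vec n × Vec n) : Vec n := ge p.1

/-- The channel output `y = x + w`. -/
def channelOutput {n : ℕ} (ge : Vec n → Vec n) (p : Vec n × Vec n) : Vec n := signal ge p + p.2

/-- The decoder's estimate `u = γᵈ(y)`. -/
def estimate {n : ℕ} (ge gd : Vec n → Vec n) (p : Vec n × Vec n) : Vec n :=
  gd (channelOutput ge p)

/-- The decoder's expected cost `E ‖m - u‖²`, an element of `[0, ∞]`. -/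
def decoderCost {n : ℕ} (Sm Sw : Matrix (Fin n) (Fin n) ℝ) (ge gd : Vec n → Vec n) : ℝ≥0∞ :=
  ∫⁻ p, ENNReal.ofReal (‖p.1 - estimate ge gd p‖ ^ 2) ∂(sourceNoiseLaw Sm Sw)

/-- The encoder's expected cost `E [‖A m - b - u‖² + ρ ‖x‖²]`, an element of `[0, ∞]`
(for `ρ ≥ 0` the integrand is nonnegative). -/
def encoderCost {n : ℕ} (A : Matrix (Fin n) (Fin n) ℝ) (b : Vec n) (ρ : ℝ)
    (Sm Sw : Matrix (Fin n) (Fin n) ℝ) (ge gd : Vec n → Vec n) : ℝ≥0∞ :=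
  ∫⁻ p, ENNReal.ofReal
      (‖Matrix.toEuclideanCLM (𝕜 := ℝ) A p.1 - b - estimate ge gd p‖ ^ 2 + ρ * ‖signal ge p‖ ^ 2)
    ∂(sourceNoiseLaw Sm Sw)

/-- The transmission power `E ‖x‖²`, an element of `[0, ∞]`. -/
def transmissionPower {n : ℕ} (Sm Sw : Matrix (Fin n) (Fin n) ℝ) (ge : Vec n → Vec n) : ℝ≥0∞ :=
  ∫⁻ p, ENNReal.ofReal (‖signal ge p‖ ^ 2) ∂(sourceNoiseLaw Sm Sw)

/-- The Borel decoder policy `gd` is a best response to the encoder policy `ge`. -/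
def IsBestResponse {n : ℕ} (Sm Sw : Matrix (Fin n) (Fin n) ℝ) (ge gd : Vec n → Vec n) : Prop :=
  Measurable gd ∧
    ∀ gd' : Vec n → Vec n, Measurable gd' →
      decoderCost Sm Sw ge gd ≤ decoderCost Sm Sw ge gd'

/-- `(ge, gd)` is a Stackelberg equilibrium with the encoder as the leader: `ge` is a Borel
encoder policy, `gd` is a best response to it, and no Borel encoder policy gives the encoder a
smaller cost once the decoder best responds to it. -/
def IsStackelbergEquilibrium {n : ℕ} (A : Matrix (Fin n) (Fin n) ℝ) (b : Vec n) (ρ : ℝ)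
    (Sm Sw : Matrix (Fin n) (Fin n) ℝ) (ge gd : Vec n → Vec n) : Prop :=
  Measurable ge ∧ IsBestResponse Sm Sw ge gd ∧
    ∀ ge' gd' : Vec n → Vec n, Measurable ge' → IsBestResponse Sm Sw ge' gd' →
      encoderCost A b ρ Sm Sw ge gd ≤ encoderCost A b ρ Sm Sw ge' gd'

/-- Under the policies `(ge, gd)` the estimate is the prior mean: `u = E[m]` almost surely. -/
def IsNonInformative {n : ℕ} (Sm Sw : Matrix (Fin n) (Fin n) ℝ) (ge gd : Vec n → Vec n) : Prop :=
  ∀ᵐ p ∂(sourceNoiseLaw Sm Sw),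
    estimate ge gd p = ∫ q, q.1 ∂(sourceNoiseLaw Sm Sw)

/-- The source `m` and the message `x` are not independent. -/
def IsInformative {n : ℕ} (Sm Sw : Matrix (Fin n) (Fin n) ℝ) (ge : Vec n → Vec n) : Prop :=
  ¬ IndepFun (fun p : Vec n × Vec n => p.1) (signal ge) (sourceNoiseLaw Sm Sw)

/-- The cost kernel `V = I - (A + Aᵀ)`. -/
def costKernel {n : ℕ} (A : Matrix (Fin n) (Fin n) ℝ) : Matrix (Fin n) (Fin n) ℝ :=
  1 - (A + A.transpose)

/-- The constant `κ = n² |Σm|^{1/n} |Σw|^{1/n}`. -/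
def kappa {n : ℕ} (Sm Sw : Matrix (Fin n) (Fin n) ℝ) : ℝ :=
  (n : ℝ) ^ 2 * Sm.det ^ ((1 : ℝ) / (n : ℝ)) * Sw.det ^ ((1 : ℝ) / (n : ℝ))

/-- The information-theoretic upper bound `Tr Σm - κ / (P + Tr Σw)` on the trace of the posterior
mean covariance `E[u uᵀ]` at transmission power `P`. -/
def posteriorTraceBound {n : ℕ} (Sm Sw : Matrix (Fin n) (Fin n) ℝ) (P : ℝ) : ℝ :=
  Sm.trace - kappa Sm Sw / (P + Sw.trace)

/-- For `A = a I`, the encoder's cost at transmission power `P`, when the decoder best responds, is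
`(1 - 2 a) Tr E[u uᵀ] + ρ P + (a² Tr Σm + ‖b‖²)`. For `a > 1/2`, putting the information-theoretic
bound in place of `Tr E[u uᵀ]` gives this lower bound on the cost. -/
def encoderCostLowerBound {n : ℕ} (a : ℝ) (b : Vec n) (ρ : ℝ)
    (Sm Sw : Matrix (Fin n) (Fin n) ℝ) (P : ℝ) : ℝ :=
  (1 - 2 * a) * posteriorTraceBound Sm Sw P + ρ * P + (a ^ 2 * Sm.trace + ‖b‖ ^ 2)

end

end GaussianSignaling

/-! A best response is characterised through orthogonality: the error `m - u` is orthogonal to every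
square-integrable function of `y`. Testing against `u` and against constants gives `E⟨m,u⟩ = E‖u‖²`
and `E u = 0`, so the encoder's cost is `(1 - 2a) E‖u‖² + ρ E‖x‖²` plus the constant `a² Tr Σm +
‖b‖²` (`IsBestResponse.encoderCost_eq`).

If `a ≤ 1/2`, both variable terms are nonnegative and silence makes them vanish. In any equilibrium
`ρ > 0` then forces `x = 0`, so `u` depends on the noise alone, and `E‖u‖² = E⟨m,u⟩ = 0` by
independence.

If `a > 1/2`, the encoder wants `E‖u‖² = Tr Σm - E‖m - u‖²` large, and `kappa_le_power_mul_error`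
limits it: `κ ≤ (P + Tr Σw) E‖m - u‖²`. This is proved without entropies. The law of `(m, w)` is
compared, by Gibbs' inequality, with the probability density `g_σ(y) g_τ(m - γᵈ(y))`, where `y =
γᵉ(m) + w` and `g_v` is the centred Gaussian density of covariance `v I`; the variances `σ`, `τ` are
then optimised. The threshold on `ρ` comes from a factorisation of the differences of the resulting
one-variable bound (`encoderCostLowerBound_sub`). -/

namespace GaussianSignaling

/-! ### Isotropic Gaussian densities and linear changes of variables. -/

section GaussianDensity

variable {E : Type*} [NormedAddCommGroup E] [InnerProductSpace ℝ E]

/-- The density of the centred Gaussian law with covariance `v • 1` on a Euclidean space. -/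
noncomputable def isotropicDensity (v : ℝ) (x : E) : ℝ :=
  (√(2 * Real.pi * v))⁻¹ ^ Module.finrank ℝ E * Real.exp (-‖x‖ ^ 2 / (2 * v))

lemma isotropicDensity_pos {v : ℝ} (hv : 0 < v) (x : E) : 0 < isotropicDensity v x := by
  unfold isotropicDensity
  positivity

lemma log_isotropicDensity {v : ℝ} (hv : 0 < v) (x : E) :
    Real.log (isotropicDensity v x) =
      -(Module.finrank ℝ E / 2 * Real.log (2 * Real.pi * v)) - ‖x‖ ^ 2 / (2 * v) := by
  unfold isotropicDensity
  rw [Real.log_mul (by positivity) (by positivity), Real.log_exp, Real.log_pow, Real.log_inv,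
    Real.log_sqrt (by positivity)]
  ring

variable [MeasurableSpace E] [BorelSpace E]

@[fun_prop]
lemma measurable_isotropicDensity (v : ℝ) : Measurable (isotropicDensity v : E → ℝ) := by
  unfold isotropicDensity
  fun_prop

variable [FiniteDimensional ℝ E]

lemma integral_isotropicDensity {v : ℝ} (hv : 0 < v) :
    ∫ x : E, isotropicDensity v x = 1 := by
  have h := GaussianFourier.integral_rexp_neg_mul_sq_norm (V := E)
    (show 0 < (2 * v)⁻¹ by positivity)
  have h' : ∀ x : E, isotropicDensity v x = (√(2 * Real.pi * v))⁻¹ ^ Module.finrank ℝ E *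
      Real.exp (-(2 * v)⁻¹ * ‖x‖ ^ 2) := fun x ↦ by
    unfold isotropicDensity; congr 2; field_simp
  simp_rw [h']
  rw [integral_const_mul, h, div_inv_eq_mul, ← mul_assoc, mul_comm Real.pi 2, Real.sqrt_eq_rpow,
    ← Real.rpow_neg (by positivity), ← Real.rpow_natCast, ← Real.rpow_mul (by positivity),
    ← Real.rpow_add (by positivity)]
  ring_nf
  simp

lemma integrable_isotropicDensity {v : ℝ} (hv : 0 < v) :
    Integrable (isotropicDensity v : E → ℝ) :=
  .of_integral_ne_zero (by simp [integral_isotropicDensity hv])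

lemma lintegral_isotropicDensity {v : ℝ} (hv : 0 < v) :
    ∫⁻ x : E, ENNReal.ofReal (isotropicDensity v x) = 1 := by
  rw [← ofReal_integral_eq_lintegral_ofReal (integrable_isotropicDensity hv)
    (.of_forall fun x ↦ (isotropicDensity_pos hv x).le), integral_isotropicDensity hv,
    ENNReal.ofReal_one]

/-- Both sides are probability measures with the same characteristic function. -/
lemma stdGaussian_eq_withDensity :
    stdGaussian E = volume.withDensity fun x ↦ ENNReal.ofReal (isotropicDensity 1 x) := by
  have : IsProbabilityMeasure
      (volume.withDensity fun x : E ↦ ENNReal.ofReal (isotropicDensity 1 x)) :=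
    ⟨by simp [lintegral_isotropicDensity]⟩
  apply Measure.ext_of_charFun
  ext t
  rw [charFun_stdGaussian, charFun_apply,
    integral_withDensity_eq_integral_toReal_smul (by fun_prop) (by simp)]
  have h := GaussianFourier.integral_cexp_neg_mul_sq_norm_add (V := E) (b := (1 / 2 : ℂ))
    (by norm_num) Complex.I t
  have h0 := GaussianFourier.integral_cexp_neg_mul_sq_norm (V := E) (b := (1 / 2 : ℂ))
    (by norm_num)
  have e (x : E) : (ENNReal.ofReal (isotropicDensity 1 x)).toReal •
      Complex.exp (inner ℝ x t * Complex.I) =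
      (((√(2 * Real.pi * 1))⁻¹ ^ Module.finrank ℝ E : ℝ) : ℂ) *
      Complex.exp (-(1 / 2) * ‖x‖ ^ 2 + Complex.I * inner ℝ t x) := by
    rw [ENNReal.toReal_ofReal (isotropicDensity_pos one_pos x).le, isotropicDensity,
      Complex.real_smul, Complex.exp_add, Complex.ofReal_mul, Complex.ofReal_exp, real_inner_comm,
      mul_comm Complex.I, mul_assoc]
    congr 3
    push_cast
    ring_nf
  -- The constant is read off from the total mass being one, which avoids simplifying the complex
  -- power directly.
  have h1 : (((√(2 * Real.pi * 1))⁻¹ ^ Module.finrank ℝ E : ℝ) : ℂ) *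
      (Real.pi / (1 / 2)) ^ (Module.finrank ℝ E / 2 : ℂ) = 1 := by
    have h2 := congrArg (fun r : ℝ ↦ (r : ℂ)) (integral_isotropicDensity (E := E) one_pos)
    rw [Complex.ofReal_one, ← integral_complex_ofReal] at h2
    rw [← h0, ← integral_const_mul]
    refine Eq.trans ?_ h2
    congr with x
    rw [isotropicDensity, Complex.ofReal_mul, Complex.ofReal_exp]
    congr 2
    push_cast
    ring_nf
  simp_rw [e]
  rw [integral_const_mul, h, ← mul_assoc, h1, one_mul]
  congr 1
  rw [Complex.I_sq]
  ring

lemma lintegral_comp_linearMap {T : E →ₗ[ℝ] E} (hT : 0 < LinearMap.det T) {f : E → ℝ≥0∞}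
    (hf : Measurable f) :
    ENNReal.ofReal (LinearMap.det T) * ∫⁻ x, f (T x) = ∫⁻ x, f x := by
  have h := Measure.map_linearMap_addHaar_eq_smul_addHaar (volume : Measure E) hT.ne'
  rw [← lintegral_map hf T.continuous_of_finiteDimensional.measurable, h, lintegral_smul_measure,
    smul_eq_mul, ← mul_assoc, abs_of_pos (inv_pos.2 hT), ← ENNReal.ofReal_mul hT.le,
    mul_inv_cancel₀ hT.ne', ENNReal.ofReal_one, one_mul]

end GaussianDensity

/-! ### Square roots and second moments of Gaussian covariances. -/

section SecondMoments

variable {n : ℕ}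

lemma det_toEuclideanCLM (S : Matrix (Fin n) (Fin n) ℝ) :
    LinearMap.det (Matrix.toEuclideanCLM (𝕜 := ℝ) S : Vec n →ₗ[ℝ] Vec n) = S.det := by
  rw [Matrix.coe_toEuclideanCLM_eq_toEuclideanLin]
  rw [Matrix.toEuclideanLin_eq_toLin_orthonormal]
  exact LinearMap.det_toLin _ _

-- Squaring gives the value; the sign comes from the root being positive semidefinite, with zero
-- excluded by `S.det > 0`.
open scoped MatrixOrder in
lemma det_cfcSqrt {S : Matrix (Fin n) (Fin n) ℝ} (hS : S.PosDef) :
    0 < (CFC.sqrt S).det ∧ (CFC.sqrt S).det ^ 2 = S.det := by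
  have h : (CFC.sqrt S).det ^ 2 = S.det := by
    rw [sq, ← Matrix.det_mul, CFC.sqrt_mul_sqrt_self _ hS.posSemidef.nonneg]
  refine ⟨lt_of_le_of_ne ?_ fun h0 ↦ hS.det_pos.ne' (by rw [← h, ← h0]; ring), h⟩
  exact (Matrix.nonneg_iff_posSemidef.1 (CFC.sqrt_nonneg S)).det_nonneg

lemma memLp_id_multivariateGaussian (S : Matrix (Fin n) (Fin n) ℝ) :
    MemLp (fun x ↦ x) 2 (multivariateGaussian (0 : Vec n) S) :=
  IsGaussian.memLp_two_id

lemma integral_norm_sq_multivariateGaussian {S : Matrix (Fin n) (Fin n) ℝ} (hS : S.PosSemidef) :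
    ∫ x : Vec n, ‖x‖ ^ 2 ∂(multivariateGaussian 0 S) = S.trace := by
  have hL (i : Fin n) : MemLp (fun x : Vec n ↦ x i) 2 (multivariateGaussian (0 : Vec n) S) :=
    (EuclideanSpace.proj i : Vec n →L[ℝ] ℝ).comp_memLp' (memLp_id_multivariateGaussian S)
  simp_rw [EuclideanSpace.real_norm_sq_eq]
  rw [integral_finsetSum _ fun i _ ↦ (hL i).integrable_sq, Matrix.trace]
  refine Finset.sum_congr rfl fun i _ ↦ ?_
  rw [Matrix.diag_apply, ← variance_eval_multivariateGaussian (μ := 0) hS i,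
    variance_of_integral_eq_zero (by fun_prop)]
  have := (EuclideanSpace.proj i : Vec n →L[ℝ] ℝ).integral_comp_comm
    (IsGaussian.integrable_id (μ := multivariateGaussian (0 : Vec n) S))
  simpa using this

end SecondMoments

/-! ### Gibbs' inequality against a Gaussian reference density. -/

section Gibbs

variable {E : Type*} [NormedAddCommGroup E] [InnerProductSpace ℝ E]
  [MeasurableSpace E] [BorelSpace E] [FiniteDimensional ℝ E]

/-- The reference density `g_σ(y) g_τ(m - γᵈ(y))` of the pair `(m, y)` is a probability density. -/
lemma lintegral_referenceDensity {ge gd : E → E} (hgd : Measurable gd)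
    {σ τ : ℝ} (hσ : 0 < σ) (hτ : 0 < τ) :
    ∫⁻ m : E, ∫⁻ w : E, ENNReal.ofReal (isotropicDensity σ (ge m + w)) *
      ENNReal.ofReal (isotropicDensity τ (m - gd (ge m + w))) = 1 := by
  have h (m : E) : ∫⁻ w : E, ENNReal.ofReal (isotropicDensity σ (ge m + w)) *
      ENNReal.ofReal (isotropicDensity τ (m - gd (ge m + w))) =
      ∫⁻ y : E, ENNReal.ofReal (isotropicDensity σ y) *
        ENNReal.ofReal (isotropicDensity τ (m - gd y)) :=
    -- For fixed `m`, passing from `w` to `y = ge m + w` is a translation, so no regularity of `ge`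
    -- is needed. After swapping the integrals, `m - gd y` is likewise a translation of `m`.
    lintegral_add_left_eq_self (μ := (volume : Measure E))
      (fun y ↦ ENNReal.ofReal (isotropicDensity σ y) *
        ENNReal.ofReal (isotropicDensity τ (m - gd y))) (ge m)
  simp_rw [h]
  rw [lintegral_lintegral_swap (by fun_prop)]
  have h2 (y : E) : ∫⁻ m : E, ENNReal.ofReal (isotropicDensity σ y) *
      ENNReal.ofReal (isotropicDensity τ (m - gd y)) =
      ENNReal.ofReal (isotropicDensity σ y) := by
    rw [lintegral_const_mul _ (by fun_prop),
      lintegral_sub_right_eq_self (μ := (volume : Measure E))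
        (fun m ↦ ENNReal.ofReal (isotropicDensity τ m)) (gd y),
      lintegral_isotropicDensity hτ, mul_one]
  simp_rw [h2]
  exact lintegral_isotropicDensity hσ

/-- The reference density pulled back to the coordinates `m = A z₁`, `w = B z₂`; the determinants
are the Jacobian that preserves its mass. -/
lemma lintegral_referenceDensity_linearMap {ge gd : E → E} (hge : Measurable ge)
    (hgd : Measurable gd) {σ τ : ℝ} (hσ : 0 < σ) (hτ : 0 < τ) {A B : E →L[ℝ] E}
    (hA : 0 < LinearMap.det (A : E →ₗ[ℝ] E)) (hB : 0 < LinearMap.det (B : E →ₗ[ℝ] E)) :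
    ∫⁻ z : E × E, ENNReal.ofReal
      (LinearMap.det (A : E →ₗ[ℝ] E) * LinearMap.det (B : E →ₗ[ℝ] E) *
        (isotropicDensity σ (ge (A z.1) + B z.2) *
          isotropicDensity τ (A z.1 - gd (ge (A z.1) + B z.2))))
      ∂((volume : Measure E).prod volume) = 1 := by
  have hB' (m : E) := lintegral_comp_linearMap hB
    (f := fun w ↦ ENNReal.ofReal (isotropicDensity σ (ge m + w)) *
      ENNReal.ofReal (isotropicDensity τ (m - gd (ge m + w)))) (by fun_prop)
  have hA' := lintegral_comp_linearMap hA
    (f := fun m ↦ ∫⁻ w, ENNReal.ofReal (isotropicDensity σ (ge m + w)) *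
      ENNReal.ofReal (isotropicDensity τ (m - gd (ge m + w))))
      (Measurable.lintegral_prod_right' (f := fun z : E × E ↦
        ENNReal.ofReal (isotropicDensity σ (ge z.1 + z.2)) *
          ENNReal.ofReal (isotropicDensity τ (z.1 - gd (ge z.1 + z.2)))) (by fun_prop))
  rw [lintegral_referenceDensity hgd hσ hτ] at hA'
  simp_rw [← hB'] at hA'
  rw [← hA', lintegral_prod _ (by fun_prop), ← lintegral_const_mul _ (by
    refine Measurable.const_mul ?_ _
    exact Measurable.lintegral_prod_right' (f := fun z : E × E ↦
        ENNReal.ofReal (isotropicDensity σ (ge (A z.1) + B z.2)) *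
          ENNReal.ofReal (isotropicDensity τ (A z.1 - gd (ge (A z.1) + B z.2)))) (by fun_prop))]
  refine lintegral_congr fun z ↦ ?_
  rw [← mul_assoc, ← ENNReal.ofReal_mul hA.le, ← lintegral_const_mul _ (by fun_prop)]
  refine lintegral_congr fun w ↦ ?_
  rw [ENNReal.ofReal_mul (by positivity), ENNReal.ofReal_mul (isotropicDensity_pos hσ _).le]
  rfl

/-- Gibbs' inequality: a likelihood ratio of total mass at most one has nonpositive expected
logarithm. -/
lemma integral_nonpos_of_lintegral_exp_le_one {Ω : Type*} [MeasurableSpace Ω] {μ : Measure Ω}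
    [IsProbabilityMeasure μ] {L : Ω → ℝ} (hL : Integrable L μ)
    (h : ∫⁻ z, ENNReal.ofReal (Real.exp (L z)) ∂μ ≤ 1) : ∫ z, L z ∂μ ≤ 0 := by
  have hm : AEStronglyMeasurable (fun z ↦ Real.exp (L z)) μ :=
    Real.continuous_exp.comp_aestronglyMeasurable hL.1
  have hi : Integrable (fun z ↦ Real.exp (L z)) μ :=
    ⟨hm, (hasFiniteIntegral_iff_ofReal (.of_forall fun z ↦ (Real.exp_pos _).le)).2
      (h.trans_lt ENNReal.one_lt_top)⟩
  have h1 : ∫ z, Real.exp (L z) ∂μ ≤ 1 := by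
    rw [integral_eq_lintegral_of_nonneg_ae (.of_forall fun z ↦ (Real.exp_pos _).le) hm]
    exact ENNReal.toReal_le_of_le_ofReal zero_le_one (by simpa using h)
  have h2 : ∫ z, L z ∂μ ≤ ∫ z, (Real.exp (L z) - 1) ∂μ :=
    integral_mono hL (hi.sub (integrable_const _)) fun z ↦ by
      have := Real.add_one_le_exp (L z)
      linarith
  rw [integral_sub hi (integrable_const _)] at h2
  simp at h2
  linarith

lemma integral_norm_sq_stdGaussian {n : ℕ} :
    ∫ x : Vec n, ‖x‖ ^ 2 ∂(stdGaussian (Vec n)) = n := by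
  simpa using integral_norm_sq_multivariateGaussian (n := n) Matrix.PosSemidef.one

lemma integrable_norm_sq_stdGaussian {n : ℕ} :
    Integrable (fun x : Vec n ↦ ‖x‖ ^ 2) (stdGaussian (Vec n)) :=
  (memLp_two_iff_integrable_sq_norm (by fun_prop)).1 IsGaussian.memLp_two_id

/-- The information inequality, for images `m = A z₁` and `w = B z₂` of standard Gaussian
vectors. -/
lemma gibbs_stdGaussian {n : ℕ} {ge gd : Vec n → Vec n} (hge : Measurable ge)
    (hgd : Measurable gd) {σ τ : ℝ} (hσ : 0 < σ) (hτ : 0 < τ) {A B : Vec n →L[ℝ] Vec n}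
    (hA : 0 < LinearMap.det (A : Vec n →ₗ[ℝ] Vec n))
    (hB : 0 < LinearMap.det (B : Vec n →ₗ[ℝ] Vec n))
    (hy : Integrable (fun z : Vec n × Vec n ↦ ‖ge (A z.1) + B z.2‖ ^ 2)
      ((stdGaussian (Vec n)).prod (stdGaussian (Vec n))))
    (hd : Integrable (fun z : Vec n × Vec n ↦ ‖A z.1 - gd (ge (A z.1) + B z.2)‖ ^ 2)
      ((stdGaussian (Vec n)).prod (stdGaussian (Vec n)))) :
    Real.log (LinearMap.det (A : Vec n →ₗ[ℝ] Vec n)) +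
        Real.log (LinearMap.det (B : Vec n →ₗ[ℝ] Vec n)) + n ≤
      n / 2 * (Real.log σ + Real.log τ) +
      (∫ z : Vec n × Vec n, ‖ge (A z.1) + B z.2‖ ^ 2
        ∂((stdGaussian (Vec n)).prod (stdGaussian (Vec n)))) / (2 * σ) +
      (∫ z : Vec n × Vec n, ‖A z.1 - gd (ge (A z.1) + B z.2)‖ ^ 2
        ∂((stdGaussian (Vec n)).prod (stdGaussian (Vec n)))) / (2 * τ) := by
  set ν := (stdGaussian (Vec n)).prod (stdGaussian (Vec n)) with hν
  set dA := LinearMap.det (A : Vec n →ₗ[ℝ] Vec n)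
  set dB := LinearMap.det (B : Vec n →ₗ[ℝ] Vec n)
  -- `R` is the reference density and `G` below the true one, both in the whitened coordinates;
  -- Gibbs' inequality is applied to `log (R / G)`.
  set R : Vec n × Vec n → ℝ := fun z ↦
    dA * dB * (isotropicDensity σ (ge (A z.1) + B z.2) *
      isotropicDensity τ (A z.1 - gd (ge (A z.1) + B z.2))) with hR
  have hRpos (z) : 0 < R z := mul_pos (mul_pos hA hB)
    (mul_pos (isotropicDensity_pos hσ _) (isotropicDensity_pos hτ _))
  set G : Vec n × Vec n → ℝ := fun z ↦ isotropicDensity 1 z.1 * isotropicDensity 1 z.2 with hG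
  have hGpos (z) : 0 < G z :=
    mul_pos (isotropicDensity_pos one_pos _) (isotropicDensity_pos one_pos _)
  have hνG : ν = ((volume : Measure (Vec n)).prod volume).withDensity
      fun z ↦ ENNReal.ofReal (G z) := by
    rw [hν, stdGaussian_eq_withDensity, prod_withDensity (by fun_prop) (by fun_prop)]
    congr with z
    rw [hG, ENNReal.ofReal_mul (isotropicDensity_pos one_pos _).le]
  have hmass : ∫⁻ z, ENNReal.ofReal (R z / G z) ∂ν ≤ 1 := by
    rw [hνG, lintegral_withDensity_eq_lintegral_mul _ (by fun_prop) (by fun_prop),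
      ← lintegral_referenceDensity_linearMap hge hgd hσ hτ hA hB]
    refine (lintegral_congr fun z ↦ ?_).le
    rw [Pi.mul_apply, ← ENNReal.ofReal_mul (hGpos z).le, mul_div_cancel₀ _ (hGpos z).ne']
  have hlog (z) : Real.log (R z / G z) = (Real.log dA + Real.log dB -
      n / 2 * (Real.log σ + Real.log τ)) + (‖z.1‖ ^ 2 / 2 + ‖z.2‖ ^ 2 / 2 -
        ‖ge (A z.1) + B z.2‖ ^ 2 / (2 * σ) -
        ‖A z.1 - gd (ge (A z.1) + B z.2)‖ ^ 2 / (2 * τ)) := by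
    have hp : (2 * Real.pi) ≠ 0 := by positivity
    rw [Real.log_div (hRpos z).ne' (hGpos z).ne', hR, hG]
    dsimp only
    rw [Real.log_mul (mul_pos hA hB).ne'
        (mul_pos (isotropicDensity_pos hσ _) (isotropicDensity_pos hτ _)).ne',
      Real.log_mul hA.ne' hB.ne',
      Real.log_mul (isotropicDensity_pos hσ _).ne' (isotropicDensity_pos hτ _).ne',
      Real.log_mul (isotropicDensity_pos one_pos _).ne' (isotropicDensity_pos one_pos _).ne',
      log_isotropicDensity hσ, log_isotropicDensity hτ, log_isotropicDensity one_pos,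
      log_isotropicDensity one_pos, Real.log_mul hp hσ.ne', Real.log_mul hp hτ.ne',
      mul_one, finrank_euclideanSpace_fin]
    ring
  have h1 : Integrable (fun z : Vec n × Vec n ↦ ‖z.1‖ ^ 2 / 2) ν :=
    (integrable_norm_sq_stdGaussian.comp_fst _).div_const 2
  have h2 : Integrable (fun z : Vec n × Vec n ↦ ‖z.2‖ ^ 2 / 2) ν :=
    (integrable_norm_sq_stdGaussian.comp_snd _).div_const 2
  have e1 : ∫ z : Vec n × Vec n, ‖z.1‖ ^ 2 ∂ν = n := by
    rw [hν, integral_fun_fst (fun x : Vec n ↦ ‖x‖ ^ 2)]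
    simp [integral_norm_sq_stdGaussian]
  have e2 : ∫ z : Vec n × Vec n, ‖z.2‖ ^ 2 ∂ν = n := by
    rw [hν, integral_fun_snd (fun x : Vec n ↦ ‖x‖ ^ 2)]
    simp [integral_norm_sq_stdGaussian]
  have hy' := hy.div_const (2 * σ)
  have hd' := hd.div_const (2 * τ)
  have h12 : Integrable (fun z : Vec n × Vec n ↦ ‖z.1‖ ^ 2 / 2 + ‖z.2‖ ^ 2 / 2) ν := h1.add h2
  have h12y : Integrable (fun z : Vec n × Vec n ↦ ‖z.1‖ ^ 2 / 2 + ‖z.2‖ ^ 2 / 2 -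
      ‖ge (A z.1) + B z.2‖ ^ 2 / (2 * σ)) ν := h12.sub hy'
  have hI : Integrable (fun z : Vec n × Vec n ↦ ‖z.1‖ ^ 2 / 2 + ‖z.2‖ ^ 2 / 2 -
      ‖ge (A z.1) + B z.2‖ ^ 2 / (2 * σ) -
      ‖A z.1 - gd (ge (A z.1) + B z.2)‖ ^ 2 / (2 * τ)) ν := h12y.sub hd'
  have key := integral_nonpos_of_lintegral_exp_le_one (μ := ν)
    (L := fun z ↦ Real.log (R z / G z))
    (by simp_rw [hlog]; exact (integrable_const _).add hI)
    (by simpa only [Real.exp_log (div_pos (hRpos _) (hGpos _))] using hmass)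
  simp_rw [hlog] at key
  rw [integral_add (integrable_const _) hI, integral_sub h12y hd',
    integral_sub h12 hy', integral_add h1 h2] at key
  simp only [integral_div, integral_const, probReal_univ, one_smul, e1, e2] at key
  linarith

open scoped MatrixOrder in
/-- The information inequality behind the bound on the estimation error. -/
theorem gibbs_sourceNoiseLaw {n : ℕ} {Sm Sw : Matrix (Fin n) (Fin n) ℝ} (hSm : Sm.PosDef)
    (hSw : Sw.PosDef) {ge gd : Vec n → Vec n} (hge : Measurable ge) (hgd : Measurable gd)
    {σ τ : ℝ} (hσ : 0 < σ) (hτ : 0 < τ)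
    (hy : Integrable (fun p ↦ ‖channelOutput ge p‖ ^ 2) (sourceNoiseLaw Sm Sw))
    (hd : Integrable (fun p ↦ ‖p.1 - estimate ge gd p‖ ^ 2) (sourceNoiseLaw Sm Sw)) :
    (Real.log Sm.det + Real.log Sw.det) / 2 + n ≤
      n / 2 * (Real.log σ + Real.log τ) +
      (∫ p, ‖channelOutput ge p‖ ^ 2 ∂(sourceNoiseLaw Sm Sw)) / (2 * σ) +
      (∫ p, ‖p.1 - estimate ge gd p‖ ^ 2 ∂(sourceNoiseLaw Sm Sw)) / (2 * τ) := by
  -- Whitening: the square roots of the covariances carry standard Gaussian vectors to `m` and `w`,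
  -- and each log-determinant is half that of the covariance.
  set A : Vec n →L[ℝ] Vec n := Matrix.toEuclideanCLM (𝕜 := ℝ) (CFC.sqrt Sm) with hA
  set B : Vec n →L[ℝ] Vec n := Matrix.toEuclideanCLM (𝕜 := ℝ) (CFC.sqrt Sw) with hB
  have hlaw : sourceNoiseLaw Sm Sw =
      ((stdGaussian (Vec n)).prod (stdGaussian (Vec n))).map (Prod.map A B) := by
    rw [← Measure.map_prod_map _ _ (by fun_prop) (by fun_prop), sourceNoiseLaw,
      multivariateGaussian, multivariateGaussian]
    simp only [zero_add, hA, hB]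
  have hΦ : Measurable (Prod.map A B) := by fun_prop
  have hym : Measurable fun p : Vec n × Vec n ↦ ‖channelOutput ge p‖ ^ 2 := by
    unfold channelOutput signal; fun_prop
  have hdm : Measurable fun p : Vec n × Vec n ↦ ‖p.1 - estimate ge gd p‖ ^ 2 := by
    unfold estimate channelOutput signal; fun_prop
  obtain ⟨hA0, hA1⟩ := det_cfcSqrt hSm
  obtain ⟨hB0, hB1⟩ := det_cfcSqrt hSw
  rw [hlaw] at hy hd ⊢
  rw [integrable_map_measure hym.aestronglyMeasurable hΦ.aemeasurable] at hy
  rw [integrable_map_measure hdm.aestronglyMeasurable hΦ.aemeasurable] at hd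
  rw [integral_map hΦ.aemeasurable hym.aestronglyMeasurable,
    integral_map hΦ.aemeasurable hdm.aestronglyMeasurable]
  have h := gibbs_stdGaussian hge hgd hσ hτ (A := A) (B := B)
    (by rwa [hA, det_toEuclideanCLM]) (by rwa [hB, det_toEuclideanCLM]) hy hd
  rw [hA, hB, det_toEuclideanCLM, det_toEuclideanCLM] at h
  rw [← hA1, ← hB1, Real.log_pow, Real.log_pow]
  refine le_of_eq_of_le ?_ h
  push_cast
  ring

end Gibbs

/-! ### Second-order calculus for square-integrable vectors. -/

section SquareIntegrable

variable {Ω E : Type*} [MeasurableSpace Ω] {μ : Measure Ω} [NormedAddCommGroup E]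

lemma integrable_norm_sq {X : Ω → E} (hX : MemLp X 2 μ) : Integrable (fun ω ↦ ‖X ω‖ ^ 2) μ :=
  (memLp_two_iff_integrable_sq_norm hX.1).1 hX

lemma lintegral_ofReal_norm_sq {X : Ω → E} (hX : MemLp X 2 μ) :
    ∫⁻ ω, ENNReal.ofReal (‖X ω‖ ^ 2) ∂μ = ENNReal.ofReal (∫ ω, ‖X ω‖ ^ 2 ∂μ) :=
  (ofReal_integral_eq_lintegral_ofReal (integrable_norm_sq hX)
    (.of_forall fun ω ↦ by positivity)).symm

lemma memLp_two_of_lintegral_ne_top {X : Ω → E} (hX : AEStronglyMeasurable X μ)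
    (h : ∫⁻ ω, ENNReal.ofReal (‖X ω‖ ^ 2) ∂μ ≠ ∞) : MemLp X 2 μ :=
  (memLp_two_iff_integrable_sq_norm hX).2 ⟨hX.norm.pow 2,
    (hasFiniteIntegral_iff_ofReal (.of_forall fun ω ↦ by positivity)).2 h.lt_top⟩

variable [InnerProductSpace ℝ E]

lemma integrable_inner_of_memLp {X Y : Ω → E} (hX : MemLp X 2 μ) (hY : MemLp Y 2 μ) :
    Integrable (fun ω ↦ inner ℝ (X ω) (Y ω)) μ := by
  have h : Integrable (fun ω ↦ (‖X ω + Y ω‖ ^ 2 - ‖X ω‖ ^ 2 - ‖Y ω‖ ^ 2) / 2) μ :=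
    (((integrable_norm_sq (hX.add hY)).sub (integrable_norm_sq hX)).sub
      (integrable_norm_sq hY)).div_const 2
  refine h.congr (.of_forall fun ω ↦ ?_)
  simp only
  rw [norm_add_sq_real]
  ring

lemma integral_norm_sub_smul_sq {X Y : Ω → E} (hX : MemLp X 2 μ) (hY : MemLp Y 2 μ) (t : ℝ) :
    ∫ ω, ‖X ω - t • Y ω‖ ^ 2 ∂μ =
      ∫ ω, ‖X ω‖ ^ 2 ∂μ - 2 * t * ∫ ω, inner ℝ (X ω) (Y ω) ∂μ + t ^ 2 * ∫ ω, ‖Y ω‖ ^ 2 ∂μ := by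
  have h (ω) : ‖X ω - t • Y ω‖ ^ 2 =
      ‖X ω‖ ^ 2 - 2 * t * inner ℝ (X ω) (Y ω) + t ^ 2 * ‖Y ω‖ ^ 2 := by
    rw [norm_sub_sq_real, norm_smul, mul_pow, real_inner_smul_right, Real.norm_eq_abs, sq_abs]
    ring
  have hi := (integrable_inner_of_memLp hX hY).const_mul (2 * t)
  have hs : Integrable (fun ω ↦ ‖X ω‖ ^ 2 - 2 * t * inner ℝ (X ω) (Y ω)) μ :=
    (integrable_norm_sq hX).sub hi
  simp_rw [h]
  rw [integral_add hs ((integrable_norm_sq hY).const_mul _),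
    integral_sub (integrable_norm_sq hX) hi, integral_const_mul, integral_const_mul]

lemma integral_norm_add_sq {X Y : Ω → E} (hX : MemLp X 2 μ) (hY : MemLp Y 2 μ) :
    ∫ ω, ‖X ω + Y ω‖ ^ 2 ∂μ =
      ∫ ω, ‖X ω‖ ^ 2 ∂μ + 2 * ∫ ω, inner ℝ (X ω) (Y ω) ∂μ + ∫ ω, ‖Y ω‖ ^ 2 ∂μ := by
  have h := integral_norm_sub_smul_sq hX hY (-1)
  simp only [neg_smul, one_smul, sub_neg_eq_add] at h
  rw [h]
  ring

/-- First-order optimality: if `X` is no longer than any `X - t Y`, it is orthogonal to `Y`. -/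
lemma integral_inner_eq_zero_of_forall_le {X Y : Ω → E} (hX : MemLp X 2 μ) (hY : MemLp Y 2 μ)
    (h : ∀ t : ℝ, ∫ ω, ‖X ω‖ ^ 2 ∂μ ≤ ∫ ω, ‖X ω - t • Y ω‖ ^ 2 ∂μ) :
    ∫ ω, inner ℝ (X ω) (Y ω) ∂μ = 0 := by
  simp_rw [integral_norm_sub_smul_sq hX hY] at h
  set I := ∫ ω, inner ℝ (X ω) (Y ω) ∂μ
  set J := ∫ ω, ‖Y ω‖ ^ 2 ∂μ
  have hJ : 0 ≤ J := integral_nonneg fun ω ↦ by positivity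
  -- The minimiser in `t` would be `I / J`; the `+ 1` covers `J = 0` and is still close enough to
  -- force `I = 0`.
  have h1 := h (I / (J + 1))
  have h2 : 2 * (I / (J + 1)) * I ≤ (I / (J + 1)) ^ 2 * J := by linarith
  rw [show 2 * (I / (J + 1)) * I = 2 * I ^ 2 * (J + 1) / (J + 1) ^ 2 by field_simp,
    show (I / (J + 1)) ^ 2 * J = I ^ 2 * J / (J + 1) ^ 2 by field_simp,
    div_le_div_iff_of_pos_right (by positivity)] at h2
  have h3 : I ^ 2 ≤ 0 := by nlinarith [mul_nonneg (sq_nonneg I) hJ]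
  exact pow_eq_zero_iff two_ne_zero |>.1 (le_antisymm h3 (sq_nonneg I))

end SquareIntegrable

/-! ### Moments under given policies and the lower bound on the estimation error. -/

section Policies

variable {n : ℕ} {Sm Sw : Matrix (Fin n) (Fin n) ℝ} {ge gd : Vec n → Vec n}

instance : IsProbabilityMeasure (sourceNoiseLaw Sm Sw) := by
  unfold sourceNoiseLaw; infer_instance

lemma measurable_signal (hge : Measurable ge) : Measurable (signal ge) := by
  unfold signal; fun_prop

lemma measurable_estimate (hge : Measurable ge) (hgd : Measurable gd) :
    Measurable (estimate ge gd) := by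
  unfold estimate channelOutput signal; fun_prop

lemma memLp_source : MemLp (fun p : Vec n × Vec n ↦ p.1) 2 (sourceNoiseLaw Sm Sw) :=
  (memLp_id_multivariateGaussian Sm).comp_fst _

lemma memLp_noise : MemLp (fun p : Vec n × Vec n ↦ p.2) 2 (sourceNoiseLaw Sm Sw) :=
  (memLp_id_multivariateGaussian Sw).comp_snd _

lemma integral_norm_sq_source (hSm : Sm.PosSemidef) :
    ∫ p, ‖p.1‖ ^ 2 ∂(sourceNoiseLaw Sm Sw) = Sm.trace := by
  rw [sourceNoiseLaw, integral_fun_fst (fun x : Vec n ↦ ‖x‖ ^ 2)]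
  simp [integral_norm_sq_multivariateGaussian hSm]

lemma integral_norm_sq_noise (hSw : Sw.PosSemidef) :
    ∫ p, ‖p.2‖ ^ 2 ∂(sourceNoiseLaw Sm Sw) = Sw.trace := by
  rw [sourceNoiseLaw, integral_fun_snd (fun x : Vec n ↦ ‖x‖ ^ 2)]
  simp [integral_norm_sq_multivariateGaussian hSw]

lemma integral_source : ∫ p, p.1 ∂(sourceNoiseLaw Sm Sw) = 0 := by
  rw [sourceNoiseLaw, integral_fun_fst (fun x : Vec n ↦ x)]
  simp

lemma integral_inner_multivariateGaussian (S : Matrix (Fin n) (Fin n) ℝ) (c : Vec n) :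
    ∫ x : Vec n, inner ℝ c x ∂(multivariateGaussian 0 S) = 0 := by
  rw [integral_inner IsGaussian.integrable_fun_id, integral_id_multivariateGaussian,
    inner_zero_right]

/-- With the noise fixed, the inner integral over the centred source vanishes. -/
lemma integral_inner_source_comp_noise {f : Vec n → Vec n}
    (hf : MemLp (fun p ↦ f p.2) 2 (sourceNoiseLaw Sm Sw)) :
    ∫ p, inner ℝ p.1 (f p.2) ∂(sourceNoiseLaw Sm Sw) = 0 := by
  have h := integrable_inner_of_memLp memLp_source hf
  rw [sourceNoiseLaw] at h ⊢
  rw [integral_prod_symm _ h]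
  simp_rw [real_inner_comm (f _), integral_inner_multivariateGaussian, integral_zero]

lemma integral_inner_comp_source_noise {f : Vec n → Vec n}
    (hf : MemLp (fun p ↦ f p.1) 2 (sourceNoiseLaw Sm Sw)) :
    ∫ p, inner ℝ (f p.1) p.2 ∂(sourceNoiseLaw Sm Sw) = 0 := by
  have h := integrable_inner_of_memLp hf memLp_noise
  rw [sourceNoiseLaw] at h ⊢
  rw [integral_prod _ h]
  simp_rw [integral_inner_multivariateGaussian, integral_zero]

lemma integral_inner_source_const (c : Vec n) :
    ∫ p, inner ℝ p.1 c ∂(sourceNoiseLaw Sm Sw) = 0 :=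
  integral_inner_source_comp_noise (f := fun _ ↦ c) (memLp_const c)

lemma memLp_channelOutput (hx : MemLp (signal ge) 2 (sourceNoiseLaw Sm Sw)) :
    MemLp (channelOutput ge) 2 (sourceNoiseLaw Sm Sw) :=
  hx.add memLp_noise

lemma integral_norm_sq_channelOutput (hSw : Sw.PosSemidef)
    (hx : MemLp (signal ge) 2 (sourceNoiseLaw Sm Sw)) :
    ∫ p, ‖channelOutput ge p‖ ^ 2 ∂(sourceNoiseLaw Sm Sw) =
      ∫ p, ‖signal ge p‖ ^ 2 ∂(sourceNoiseLaw Sm Sw) + Sw.trace := by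
  have h := integral_norm_add_sq hx memLp_noise
  have h0 : ∫ p, inner ℝ (signal ge p) p.2 ∂(sourceNoiseLaw Sm Sw) = 0 :=
    integral_inner_comp_source_noise (f := ge) hx
  rw [integral_norm_sq_noise hSw, h0] at h
  simpa [channelOutput] using h

/-- Every estimate made from the channel output has mean square error at least
`κ / (P + Tr Σw)`. -/
theorem kappa_le_power_mul_error (hn : 0 < n) (hSm : Sm.PosDef) (hSw : Sw.PosDef)
    (hge : Measurable ge) (hgd : Measurable gd)
    (hx : MemLp (signal ge) 2 (sourceNoiseLaw Sm Sw))
    (hu : MemLp (estimate ge gd) 2 (sourceNoiseLaw Sm Sw)) :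
    kappa Sm Sw ≤ (∫ p, ‖signal ge p‖ ^ 2 ∂(sourceNoiseLaw Sm Sw) + Sw.trace) *
      ∫ p, ‖p.1 - estimate ge gd p‖ ^ 2 ∂(sourceNoiseLaw Sm Sw) := by
  have : Nonempty (Fin n) := ⟨⟨0, hn⟩⟩
  have hn' : (0 : ℝ) < n := by exact_mod_cast hn
  have hgibbs := fun {σ τ : ℝ} (hσ : 0 < σ) (hτ : 0 < τ) ↦
    gibbs_sourceNoiseLaw hSm hSw hge hgd hσ hτ (integrable_norm_sq (memLp_channelOutput hx))
      (integrable_norm_sq (memLp_source.sub hu))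
  rw [integral_norm_sq_channelOutput hSw.posSemidef hx] at hgibbs
  have hP : 0 ≤ ∫ p, ‖signal ge p‖ ^ 2 ∂(sourceNoiseLaw Sm Sw) :=
    integral_nonneg fun p ↦ by positivity
  have hd : 0 ≤ ∫ p, ‖p.1 - estimate ge gd p‖ ^ 2 ∂(sourceNoiseLaw Sm Sw) :=
    integral_nonneg fun p ↦ by positivity
  have hT := hSw.trace_pos
  set s := ∫ p, ‖signal ge p‖ ^ 2 ∂(sourceNoiseLaw Sm Sw) + Sw.trace
  set d := ∫ p, ‖p.1 - estimate ge gd p‖ ^ 2 ∂(sourceNoiseLaw Sm Sw)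
  have hs : 0 < s := by positivity
  -- The error `d` is not yet known to be positive, while `τ` must be; hence `d' > d`, with a limit
  -- taken at the end.
  have hbound : ∀ d' > d, kappa Sm Sw ≤ s * d' := by
    intro d' hd'
    have hd0 : 0 < d' := hd.trans_lt hd'
    -- `σ = s / n` minimises `n/2 * log σ + s / (2σ)`, and `τ = d' / n` does the same with `d'` for
    -- `s`; the two quotients then add up to at most the `n` on the left.
    have h := hgibbs (div_pos hs hn') (div_pos hd0 hn')
    have e1 : s / (2 * (s / n)) = n / 2 := by field_simp
    have e2 : d / (2 * (d' / n)) ≤ n / 2 := by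
      rw [div_le_div_iff₀ (by positivity) two_pos, show (n : ℝ) * (2 * (d' / n)) = d' * 2 by
        field_simp]
      linarith
    rw [e1, ← Real.log_mul (div_pos hs hn').ne' (div_pos hd0 hn').ne'] at h
    have h3 : Real.log Sm.det * (1 / n) + Real.log Sw.det * (1 / n) ≤
        Real.log (s / n * (d' / n)) := by
      rw [← add_mul, mul_one_div, div_le_iff₀ hn']
      linarith
    have h4 := Real.exp_le_exp.2 h3
    rw [Real.exp_add, ← Real.rpow_def_of_pos hSm.det_pos, ← Real.rpow_def_of_pos hSw.det_pos,
      Real.exp_log (by positivity)] at h4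
    calc kappa Sm Sw
        = n ^ 2 * (Sm.det ^ ((1 : ℝ) / n) * Sw.det ^ ((1 : ℝ) / n)) := by
          rw [kappa]; ring
      _ ≤ n ^ 2 * (s / n * (d' / n)) := by gcongr
      _ = s * d' := by field_simp
  rw [← div_le_iff₀' hs]
  exact le_of_forall_gt_imp_ge_of_dense fun d' hd' ↦ (div_le_iff₀' hs).2 (hbound d' hd')

end Policies

/-! ### Best responses: orthogonality and the resulting costs. -/

section BestResponse

variable {n : ℕ} {Sm Sw : Matrix (Fin n) (Fin n) ℝ} {ge gd : Vec n → Vec n}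

lemma decoderCost_eq (hu : MemLp (estimate ge gd) 2 (sourceNoiseLaw Sm Sw)) :
    decoderCost Sm Sw ge gd =
      ENNReal.ofReal (∫ p, ‖p.1 - estimate ge gd p‖ ^ 2 ∂(sourceNoiseLaw Sm Sw)) :=
  lintegral_ofReal_norm_sq (memLp_source.sub hu)

lemma memLp_estimate_of_decoderCost_ne_top (hge : Measurable ge) (hgd : Measurable gd)
    (h : decoderCost Sm Sw ge gd ≠ ∞) : MemLp (estimate ge gd) 2 (sourceNoiseLaw Sm Sw) := by
  have hm := measurable_estimate hge hgd
  have h1 : MemLp (fun p ↦ p.1 - estimate ge gd p) 2 (sourceNoiseLaw Sm Sw) :=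
    memLp_two_of_lintegral_ne_top (by fun_prop) h
  refine (memLp_source.sub h1).ae_eq (.of_forall fun p ↦ ?_)
  simp

lemma memLp_estimate_zero : MemLp (estimate ge fun _ ↦ 0) 2 (sourceNoiseLaw Sm Sw) :=
  memLp_const (0 : Vec n)

/-- The zero decoder has finite cost, hence so does a best response. -/
lemma IsBestResponse.memLp_estimate (hge : Measurable ge) (h : IsBestResponse Sm Sw ge gd) :
    MemLp (estimate ge gd) 2 (sourceNoiseLaw Sm Sw) := by
  refine memLp_estimate_of_decoderCost_ne_top hge h.1 (ne_top_of_le_ne_top ?_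
    (h.2 (fun _ ↦ 0) measurable_const))
  rw [decoderCost_eq memLp_estimate_zero]
  exact ENNReal.ofReal_ne_top

/-- The orthogonality principle for a best response. -/
lemma IsBestResponse.integral_inner_eq_zero (hge : Measurable ge)
    (h : IsBestResponse Sm Sw ge gd) {v : Vec n → Vec n} (hv : Measurable v)
    (hv2 : MemLp (estimate ge v) 2 (sourceNoiseLaw Sm Sw)) :
    ∫ p, inner ℝ (p.1 - estimate ge gd p) (estimate ge v p) ∂(sourceNoiseLaw Sm Sw) = 0 := by
  have hu := h.memLp_estimate hge
  refine integral_inner_eq_zero_of_forall_le (memLp_source.sub hu) hv2 fun t ↦ ?_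
  have hgd := h.1
  have hut : MemLp (estimate ge fun y ↦ gd y + t • v y) 2 (sourceNoiseLaw Sm Sw) :=
    hu.add (hv2.const_smul t)
  have h1 := h.2 (fun y ↦ gd y + t • v y) (by fun_prop)
  rw [decoderCost_eq hu, decoderCost_eq hut,
    ENNReal.ofReal_le_ofReal_iff (integral_nonneg fun p ↦ by positivity)] at h1
  refine h1.trans_eq (integral_congr_ae (.of_forall fun p ↦ ?_))
  simp only [estimate, sub_sub]

lemma IsBestResponse.integral_inner_estimate (hge : Measurable ge)
    (h : IsBestResponse Sm Sw ge gd) :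
    ∫ p, inner ℝ p.1 (estimate ge gd p) ∂(sourceNoiseLaw Sm Sw) =
      ∫ p, ‖estimate ge gd p‖ ^ 2 ∂(sourceNoiseLaw Sm Sw) := by
  have hu := h.memLp_estimate hge
  have h1 := h.integral_inner_eq_zero hge h.1 hu
  simp_rw [inner_sub_left, real_inner_self_eq_norm_sq] at h1
  rw [integral_sub (integrable_inner_of_memLp memLp_source hu) (integrable_norm_sq hu)] at h1
  linarith

/-- Orthogonality against constant decoders: the estimate inherits the zero mean of the source. This
removes the cross term with `b` from the encoder's cost. -/
lemma IsBestResponse.integral_estimate_inner_const (hge : Measurable ge)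
    (h : IsBestResponse Sm Sw ge gd) (c : Vec n) :
    ∫ p, inner ℝ (estimate ge gd p) c ∂(sourceNoiseLaw Sm Sw) = 0 := by
  have hu := h.memLp_estimate hge
  have h1 := h.integral_inner_eq_zero hge (v := fun _ ↦ c) measurable_const (memLp_const c)
  have e : estimate ge (fun _ ↦ c) = fun _ ↦ c := rfl
  simp only [e, inner_sub_left] at h1
  rw [integral_sub (integrable_inner_of_memLp memLp_source (memLp_const c))
    (integrable_inner_of_memLp hu (memLp_const c)), integral_inner_source_const] at h1
  linarith

lemma IsBestResponse.integral_error (hSm : Sm.PosSemidef) (hge : Measurable ge)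
    (h : IsBestResponse Sm Sw ge gd) :
    ∫ p, ‖p.1 - estimate ge gd p‖ ^ 2 ∂(sourceNoiseLaw Sm Sw) =
      Sm.trace - ∫ p, ‖estimate ge gd p‖ ^ 2 ∂(sourceNoiseLaw Sm Sw) := by
  have h1 := integral_norm_sub_smul_sq memLp_source (h.memLp_estimate hge) 1
  simp only [one_smul] at h1
  rw [h1, h.integral_inner_estimate hge, integral_norm_sq_source hSm]
  ring

/-- The encoder's cost when the decoder best responds. -/
lemma IsBestResponse.encoderCost_eq (hSm : Sm.PosSemidef) (hge : Measurable ge)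
    (h : IsBestResponse Sm Sw ge gd) (hx : MemLp (signal ge) 2 (sourceNoiseLaw Sm Sw)) (a : ℝ)
    (b : Vec n) {ρ : ℝ} (hρ : 0 < ρ) :
    encoderCost (a • (1 : Matrix (Fin n) (Fin n) ℝ)) b ρ Sm Sw ge gd =
      ENNReal.ofReal ((1 - 2 * a) * ∫ p, ‖estimate ge gd p‖ ^ 2 ∂(sourceNoiseLaw Sm Sw) +
        ρ * ∫ p, ‖signal ge p‖ ^ 2 ∂(sourceNoiseLaw Sm Sw) + (a ^ 2 * Sm.trace + ‖b‖ ^ 2)) := by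
  have hu := h.memLp_estimate hge
  have hc : MemLp (fun _ : Vec n × Vec n ↦ b) 2 (sourceNoiseLaw Sm Sw) := memLp_const b
  have e (p : Vec n × Vec n) :
      ‖Matrix.toEuclideanCLM (𝕜 := ℝ) (a • (1 : Matrix (Fin n) (Fin n) ℝ)) p.1 - b -
        estimate ge gd p‖ ^ 2 + ρ * ‖signal ge p‖ ^ 2 =
      a ^ 2 * ‖p.1‖ ^ 2 + ‖b‖ ^ 2 + ‖estimate ge gd p‖ ^ 2 -
        2 * a * inner ℝ p.1 (estimate ge gd p) - 2 * a * inner ℝ p.1 b +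
        2 * inner ℝ (estimate ge gd p) b + ρ * ‖signal ge p‖ ^ 2 := by
    have ha : Matrix.toEuclideanCLM (𝕜 := ℝ) (a • (1 : Matrix (Fin n) (Fin n) ℝ)) p.1 =
        a • p.1 := by simp
    rw [ha, norm_sub_sq_real, norm_sub_sq_real, inner_sub_left, norm_smul, mul_pow,
      real_inner_smul_left, real_inner_smul_left, Real.norm_eq_abs, sq_abs,
      real_inner_comm (estimate ge gd p) b]
    ring
  have i1 := (integrable_norm_sq (memLp_source (Sm := Sm) (Sw := Sw))).const_mul (a ^ 2)
  have i2 : Integrable (fun p : Vec n × Vec n ↦ a ^ 2 * ‖p.1‖ ^ 2 + ‖b‖ ^ 2)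
    (sourceNoiseLaw Sm Sw) := i1.add (integrable_const _)
  have i3 : Integrable (fun p ↦ a ^ 2 * ‖p.1‖ ^ 2 + ‖b‖ ^ 2 + ‖estimate ge gd p‖ ^ 2)
    (sourceNoiseLaw Sm Sw) := i2.add (integrable_norm_sq hu)
  have j4 := (integrable_inner_of_memLp memLp_source hu).const_mul (2 * a)
  have i4 : Integrable (fun p ↦ a ^ 2 * ‖p.1‖ ^ 2 + ‖b‖ ^ 2 + ‖estimate ge gd p‖ ^ 2 -
    2 * a * inner ℝ p.1 (estimate ge gd p)) (sourceNoiseLaw Sm Sw) := i3.sub j4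
  have j5 := (integrable_inner_of_memLp memLp_source hc).const_mul (2 * a)
  have i5 : Integrable (fun p ↦ a ^ 2 * ‖p.1‖ ^ 2 + ‖b‖ ^ 2 + ‖estimate ge gd p‖ ^ 2 -
    2 * a * inner ℝ p.1 (estimate ge gd p) - 2 * a * inner ℝ p.1 b)
    (sourceNoiseLaw Sm Sw) := i4.sub j5
  have j6 := (integrable_inner_of_memLp hu hc).const_mul 2
  have i6 : Integrable (fun p ↦ a ^ 2 * ‖p.1‖ ^ 2 + ‖b‖ ^ 2 + ‖estimate ge gd p‖ ^ 2 -
    2 * a * inner ℝ p.1 (estimate ge gd p) - 2 * a * inner ℝ p.1 b +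
    2 * inner ℝ (estimate ge gd p) b) (sourceNoiseLaw Sm Sw) := i5.add j6
  have j7 := (integrable_norm_sq hx).const_mul ρ
  have i7 : Integrable (fun p ↦ a ^ 2 * ‖p.1‖ ^ 2 + ‖b‖ ^ 2 + ‖estimate ge gd p‖ ^ 2 -
    2 * a * inner ℝ p.1 (estimate ge gd p) - 2 * a * inner ℝ p.1 b +
    2 * inner ℝ (estimate ge gd p) b + ρ * ‖signal ge p‖ ^ 2) (sourceNoiseLaw Sm Sw) :=
    i6.add j7
  rw [encoderCost, ← ofReal_integral_eq_lintegral_ofReal (by simpa only [e] using i7)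
    (.of_forall fun p ↦ by positivity)]
  congr 1
  simp_rw [e]
  rw [integral_add i6 j7, integral_add i5 j6, integral_sub i4 j5, integral_sub i3 j4,
    integral_add i2 (integrable_norm_sq hu), integral_add i1 (integrable_const _)]
  simp only [integral_const_mul, integral_const, probReal_univ, one_smul,
    integral_norm_sq_source hSm, h.integral_inner_estimate hge, integral_inner_source_const,
    h.integral_estimate_inner_const hge]
  ring

/-- Since `ρ > 0`, the power term alone would make the cost infinite. -/
lemma memLp_signal_of_encoderCost_ne_top (hge : Measurable ge) {A : Matrix (Fin n) (Fin n) ℝ}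
    {b : Vec n} {ρ : ℝ} (hρ : 0 < ρ) (h : encoderCost A b ρ Sm Sw ge gd ≠ ∞) :
    MemLp (signal ge) 2 (sourceNoiseLaw Sm Sw) := by
  have hm := measurable_signal hge
  refine memLp_two_of_lintegral_ne_top hm.aestronglyMeasurable fun htop ↦ h (top_unique ?_)
  calc ∞ = ENNReal.ofReal ρ *
        ∫⁻ p, ENNReal.ofReal (‖signal ge p‖ ^ 2) ∂(sourceNoiseLaw Sm Sw) := by
        rw [htop, ENNReal.mul_top (by simpa using hρ)]
    _ = ∫⁻ p, ENNReal.ofReal (ρ * ‖signal ge p‖ ^ 2) ∂(sourceNoiseLaw Sm Sw) := by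
        rw [← lintegral_const_mul _ (by fun_prop)]
        simp_rw [ENNReal.ofReal_mul hρ.le]
    _ ≤ _ := lintegral_mono fun p ↦ ENNReal.ofReal_le_ofReal (by
        have := sq_nonneg ‖Matrix.toEuclideanCLM (𝕜 := ℝ) A p.1 - b - estimate ge gd p‖
        linarith)

end BestResponse

/-! ### Equilibria for `a ≤ 1/2` and the cost bound for `a > 1/2`. -/

section Equilibrium

variable {n : ℕ} {Sm Sw : Matrix (Fin n) (Fin n) ℝ} {ge gd : Vec n → Vec n}

/-- Without a signal the output is pure noise, so `E⟨m,u⟩ = 0` and any estimate adds `E‖u‖²` to the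
error. -/
lemma isBestResponse_zero : IsBestResponse Sm Sw (fun _ ↦ 0) (fun _ ↦ 0) := by
  refine ⟨measurable_const, fun gd hgd ↦ ?_⟩
  by_cases htop : decoderCost Sm Sw (fun _ ↦ 0) gd = ∞
  · simp [htop]
  have hu := memLp_estimate_of_decoderCost_ne_top measurable_const hgd htop
  rw [decoderCost_eq hu, decoderCost_eq memLp_estimate_zero]
  have h1 := integral_norm_sub_smul_sq memLp_source hu 1
  have h2 : ∫ p, inner ℝ p.1 (estimate (fun _ ↦ 0) gd p) ∂(sourceNoiseLaw Sm Sw) = 0 :=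
    integral_inner_source_comp_noise (f := fun w ↦ gd (0 + w)) hu
  have h3 : 0 ≤ ∫ p, ‖estimate (fun _ ↦ 0) gd p‖ ^ 2 ∂(sourceNoiseLaw Sm Sw) :=
    integral_nonneg fun p ↦ by positivity
  simp only [one_smul] at h1
  rw [h1, h2]
  refine ENNReal.ofReal_le_ofReal ?_
  simp only [estimate, sub_zero] at h3 ⊢
  linarith

lemma encoderCost_zero (hSm : Sm.PosSemidef) (a : ℝ) (b : Vec n) {ρ : ℝ} (hρ : 0 < ρ) :
    encoderCost (a • (1 : Matrix (Fin n) (Fin n) ℝ)) b ρ Sm Sw (fun _ ↦ 0) (fun _ ↦ 0) =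
      ENNReal.ofReal (a ^ 2 * Sm.trace + ‖b‖ ^ 2) := by
  have hx : MemLp (signal fun _ ↦ (0 : Vec n)) 2 (sourceNoiseLaw Sm Sw) :=
    memLp_const (0 : Vec n)
  rw [isBestResponse_zero.encoderCost_eq hSm measurable_const hx a b hρ]
  simp [estimate, signal]

/-- With an aligned cost kernel, not signaling is an equilibrium. -/
theorem isStackelbergEquilibrium_zero (hSm : Sm.PosSemidef) {a : ℝ} (ha : a ≤ 1 / 2) (b : Vec n)
    {ρ : ℝ} (hρ : 0 < ρ) :
    IsStackelbergEquilibrium (a • (1 : Matrix (Fin n) (Fin n) ℝ)) b ρ Sm Sw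
      (fun _ ↦ 0) (fun _ ↦ 0) := by
  refine ⟨measurable_const, isBestResponse_zero, fun ge gd hge hgd ↦ ?_⟩
  by_cases htop : encoderCost (a • (1 : Matrix (Fin n) (Fin n) ℝ)) b ρ Sm Sw ge gd = ∞
  · simp [htop]
  have hx := memLp_signal_of_encoderCost_ne_top hge hρ htop
  rw [encoderCost_zero hSm a b hρ, hgd.encoderCost_eq hSm hge hx a b hρ]
  refine ENNReal.ofReal_le_ofReal (le_add_of_nonneg_left (add_nonneg (mul_nonneg (by linarith) ?_)
    (mul_nonneg hρ.le ?_))) <;> exact integral_nonneg fun p ↦ by positivity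

/-- With an aligned cost kernel, no signal is sent in any equilibrium. -/
theorem IsStackelbergEquilibrium.signal_estimate_eq_zero (hSm : Sm.PosSemidef) {a : ℝ}
    (ha : a ≤ 1 / 2) {b : Vec n} {ρ : ℝ} (hρ : 0 < ρ)
    (h : IsStackelbergEquilibrium (a • (1 : Matrix (Fin n) (Fin n) ℝ)) b ρ Sm Sw ge gd) :
    ∀ᵐ p ∂(sourceNoiseLaw Sm Sw), signal ge p = 0 ∧ estimate ge gd p = 0 := by
  obtain ⟨hge, hgd, hmin⟩ := h
  have hle := hmin _ _ measurable_const isBestResponse_zero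
  rw [encoderCost_zero hSm a b hρ] at hle
  have hx := memLp_signal_of_encoderCost_ne_top hge hρ
    (ne_top_of_le_ne_top ENNReal.ofReal_ne_top hle)
  have hu := hgd.memLp_estimate hge
  have htr := hSm.trace_nonneg
  have hU : 0 ≤ ∫ p, ‖estimate ge gd p‖ ^ 2 ∂(sourceNoiseLaw Sm Sw) :=
    integral_nonneg fun p ↦ by positivity
  have hP : 0 ≤ ∫ p, ‖signal ge p‖ ^ 2 ∂(sourceNoiseLaw Sm Sw) :=
    integral_nonneg fun p ↦ by positivity
  rw [hgd.encoderCost_eq hSm hge hx a b hρ, ENNReal.ofReal_le_ofReal_iff (by positivity)] at hle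
  have hP0 : ∫ p, ‖signal ge p‖ ^ 2 ∂(sourceNoiseLaw Sm Sw) = 0 := by
    have := mul_nonneg (show 0 ≤ 1 - 2 * a by linarith) hU
    refine le_antisymm (nonpos_of_mul_nonpos_right (a := ρ) ?_ hρ) hP
    linarith
  have zero_of {X : Vec n × Vec n → Vec n} (hX : MemLp X 2 (sourceNoiseLaw Sm Sw))
      (h0 : ∫ p, ‖X p‖ ^ 2 ∂(sourceNoiseLaw Sm Sw) = 0) :
      ∀ᵐ p ∂(sourceNoiseLaw Sm Sw), X p = 0 := by
    filter_upwards [(integral_eq_zero_iff_of_nonneg (fun p ↦ by positivity)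
      (integrable_norm_sq hX)).1 h0] with p hp
    simpa using hp
  have hx0 := zero_of hx hP0
  have hae : estimate ge gd =ᵐ[sourceNoiseLaw Sm Sw] fun p ↦ gd p.2 := by
    filter_upwards [hx0] with p hp
    simp [estimate, channelOutput, hp]
  -- At `a = 1/2` the cost does not see `E‖u‖²`; its vanishing comes from `E‖u‖² = E⟨m,u⟩` and
  -- independence of source and noise.
  have hU0 : ∫ p, ‖estimate ge gd p‖ ^ 2 ∂(sourceNoiseLaw Sm Sw) = 0 := by
    rw [← hgd.integral_inner_estimate hge,
      ← integral_inner_source_comp_noise (hu.ae_eq hae)]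
    refine integral_congr_ae ?_
    filter_upwards [hae] with p hp
    rw [hp]
  filter_upwards [hx0, zero_of hu hU0] with p h1 h2 using ⟨h1, h2⟩

lemma not_isInformative_of_signal_eq_zero
    (h : ∀ᵐ p ∂(sourceNoiseLaw Sm Sw), signal ge p = 0) : ¬ IsInformative Sm Sw ge := by
  have h0 : IndepFun (fun p : Vec n × Vec n ↦ p.1) (fun _ : Vec n × Vec n ↦ (0 : Vec n))
      (sourceNoiseLaw Sm Sw) := indepFun_const_right _ 0
  rw [IsInformative, not_not]
  refine h0.congr (.of_forall fun _ ↦ rfl) ?_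
  filter_upwards [h] with p hp using hp.symm

/-- With a conflicting cost kernel, the information inequality bounds the encoder's cost. -/
theorem encoderCostLowerBound_le_encoderCost (hn : 0 < n) (hSm : Sm.PosDef) (hSw : Sw.PosDef)
    {a : ℝ} (ha : 1 / 2 < a) (b : Vec n) {ρ : ℝ} (hρ : 0 < ρ) {P : ℝ} (hge : Measurable ge)
    (hgd : IsBestResponse Sm Sw ge gd) (hP : 0 ≤ P)
    (hPow : transmissionPower Sm Sw ge = ENNReal.ofReal P) :
    ENNReal.ofReal (encoderCostLowerBound a b ρ Sm Sw P) ≤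
      encoderCost (a • (1 : Matrix (Fin n) (Fin n) ℝ)) b ρ Sm Sw ge gd := by
  have : Nonempty (Fin n) := ⟨⟨0, hn⟩⟩
  have hx : MemLp (signal ge) 2 (sourceNoiseLaw Sm Sw) :=
    memLp_two_of_lintegral_ne_top (measurable_signal hge).aestronglyMeasurable
      (by rw [← transmissionPower, hPow]; exact ENNReal.ofReal_ne_top)
  rw [transmissionPower, lintegral_ofReal_norm_sq hx,
    ENNReal.ofReal_eq_ofReal_iff (integral_nonneg fun p ↦ by positivity) hP] at hPow
  have hk := kappa_le_power_mul_error hn hSm hSw hge hgd.1 hx (hgd.memLp_estimate hge)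
  rw [hgd.integral_error hSm.posSemidef hge, hPow] at hk
  rw [hgd.encoderCost_eq hSm.posSemidef hge hx a b hρ, hPow]
  have hT := hSw.trace_pos
  have hk' := (div_le_iff₀' (by positivity)).2 hk
  refine ENNReal.ofReal_le_ofReal ?_
  rw [encoderCostLowerBound, posteriorTraceBound]
  have := mul_le_mul_of_nonneg_left hk' (show 0 ≤ 2 * a - 1 by linarith)
  linarith

end Equilibrium

/-! ### Minimisation of the one-variable lower bound. -/

section Threshold

variable {n : ℕ} {Sm Sw : Matrix (Fin n) (Fin n) ℝ}

lemma kappa_pos (hn : 0 < n) (hSm : Sm.PosDef) (hSw : Sw.PosDef) : 0 < kappa Sm Sw := by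
  have := hSm.det_pos
  have := hSw.det_pos
  unfold kappa
  positivity

lemma encoderCostLowerBound_sub (a : ℝ) (b : Vec n) (ρ : ℝ) {P Q : ℝ} (hP : P + Sw.trace ≠ 0)
    (hQ : Q + Sw.trace ≠ 0) :
    encoderCostLowerBound a b ρ Sm Sw Q - encoderCostLowerBound a b ρ Sm Sw P =
      (Q - P) * (ρ - (2 * a - 1) * kappa Sm Sw / ((P + Sw.trace) * (Q + Sw.trace))) := by
  unfold encoderCostLowerBound posteriorTraceBound
  field_simp
  ring

/-- Dividing the factored difference by `P` bounds `ρ` by a quantity strictly below the threshold.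
The weak hypothesis lets it serve both minimisers and strict improvements. -/
lemma lt_threshold_of_le {a : ℝ} {b : Vec n} {ρ P : ℝ} (hc : 0 < (2 * a - 1) * kappa Sm Sw)
    (hT : 0 < Sw.trace) (hP : 0 < P)
    (h : encoderCostLowerBound a b ρ Sm Sw P ≤ encoderCostLowerBound a b ρ Sm Sw 0) :
    ρ < (2 * a - 1) * (kappa Sm Sw / Sw.trace ^ 2) := by
  have h1 := encoderCostLowerBound_sub (Sm := Sm) a b ρ (P := 0) (Q := P)
    (Sw := Sw) (by positivity) (by positivity)
  rw [sub_zero, zero_add] at h1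
  have h2 := nonpos_of_mul_nonpos_right (h1 ▸ sub_nonpos.2 h) hP
  have h3 : (2 * a - 1) * kappa Sm Sw / (Sw.trace * (P + Sw.trace)) <
      (2 * a - 1) * kappa Sm Sw / (Sw.trace ^ 2) :=
    div_lt_div_of_pos_left hc (by positivity) (by nlinarith)
  rw [← mul_div_assoc]
  linarith

lemma exists_isMinOn_of_lt_threshold {a : ℝ} {b : Vec n} {ρ : ℝ} (hρ : 0 < ρ)
    (hc : 0 < (2 * a - 1) * kappa Sm Sw) (hT : 0 < Sw.trace)
    (h : ρ < (2 * a - 1) * (kappa Sm Sw / Sw.trace ^ 2)) :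
    ∃ P, 0 < P ∧ IsMinOn (encoderCostLowerBound a b ρ Sm Sw) (Set.Ici 0) P ∧
      encoderCostLowerBound a b ρ Sm Sw P < encoderCostLowerBound a b ρ Sm Sw 0 := by
  -- Stationarity of the bound at `P` reads `ρ (P + Tr Σw)² = (2a - 1) κ`; `r` is this value of `P +
  -- Tr Σw`, and the threshold condition says exactly that `r` exceeds `Tr Σw`.
  set r := √((2 * a - 1) * kappa Sm Sw / ρ) with hr
  have hr2 : ρ * r ^ 2 = (2 * a - 1) * kappa Sm Sw := by
    rw [hr, Real.sq_sqrt (by positivity)]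
    field_simp
  have hr0 : 0 < r := Real.sqrt_pos.2 (by positivity)
  have hrT : Sw.trace < r := by
    refine Real.lt_sqrt_of_sq_lt ?_
    rw [← mul_div_assoc, lt_div_iff₀ (by positivity)] at h
    rw [lt_div_iff₀ hρ]
    linarith
  -- At the stationary point the difference is a perfect square over a positive number, giving
  -- global minimality, and strictness at `Q = 0`.
  have hsub {Q : ℝ} (hQ : 0 ≤ Q) : encoderCostLowerBound a b ρ Sm Sw Q -
      encoderCostLowerBound a b ρ Sm Sw (r - Sw.trace) =
        ρ * (Q + Sw.trace - r) ^ 2 / (Q + Sw.trace) := by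
    have hQT : Q + Sw.trace ≠ 0 := by positivity
    rw [encoderCostLowerBound_sub a b ρ (by simpa using hr0.ne') hQT, ← hr2, sub_add_cancel]
    field_simp
    ring
  refine ⟨r - Sw.trace, sub_pos.2 hrT, fun Q hQ ↦ ?_, ?_⟩
  · have hQ0 : 0 ≤ Q := hQ
    have : 0 ≤ ρ * (Q + Sw.trace - r) ^ 2 / (Q + Sw.trace) := by positivity
    exact sub_nonneg.1 (hsub hQ0 ▸ this)
  · have : 0 < ρ * (0 + Sw.trace - r) ^ 2 / (0 + Sw.trace) := by
      have : 0 + Sw.trace - r ≠ 0 := by rw [zero_add]; exact (sub_neg.2 hrT).ne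
      positivity
    exact sub_pos.1 (hsub le_rfl ▸ this)

end Threshold

end GaussianSignaling

open GaussianSignaling

theorem mainTheorem3 (n : ℕ) (hn : 0 < n) (Sm Sw : Matrix (Fin n) (Fin n) ℝ)
    (hSm : Sm.PosDef) (hSw : Sw.PosDef) (a : ℝ) (ha : 0 < a)
    (b : EuclideanSpace ℝ (Fin n)) (ρ : ℝ) (hρ : 0 < ρ) :
    GaussianSignaling.costKernel (a • (1 : Matrix (Fin n) (Fin n) ℝ)) =
        (1 - 2 * a) • (1 : Matrix (Fin n) (Fin n) ℝ) ∧
    (a ≤ 1 / 2 →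
      GaussianSignaling.IsStackelbergEquilibrium (a • (1 : Matrix (Fin n) (Fin n) ℝ)) b ρ Sm Sw
          (fun _ => 0) (fun _ => 0) ∧
      ∀ ge gd : EuclideanSpace ℝ (Fin n) → EuclideanSpace ℝ (Fin n),
        GaussianSignaling.IsStackelbergEquilibrium (a • (1 : Matrix (Fin n) (Fin n) ℝ)) b ρ Sm Sw
            ge gd →
          (∀ᵐ p ∂(GaussianSignaling.sourceNoiseLaw Sm Sw),
            GaussianSignaling.signal ge p = 0 ∧ GaussianSignaling.estimate ge gd p = 0) ∧
          GaussianSignaling.IsNonInformative Sm Sw ge gd ∧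
          ¬ GaussianSignaling.IsInformative Sm Sw ge) ∧
    (1 / 2 < a →
      (∀ (ge gd : EuclideanSpace ℝ (Fin n) → EuclideanSpace ℝ (Fin n)) (P : ℝ),
        Measurable ge → GaussianSignaling.IsBestResponse Sm Sw ge gd → 0 ≤ P →
        GaussianSignaling.transmissionPower Sm Sw ge = ENNReal.ofReal P →
          ENNReal.ofReal (GaussianSignaling.encoderCostLowerBound a b ρ Sm Sw P) ≤
            GaussianSignaling.encoderCost (a • (1 : Matrix (Fin n) (Fin n) ℝ)) b ρ Sm Sw ge gd) ∧
      ((∃ P : ℝ, 0 < P ∧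
          IsMinOn (GaussianSignaling.encoderCostLowerBound a b ρ Sm Sw) (Set.Ici 0) P) ↔
        ρ < (2 * a - 1) *
          ((n : ℝ) ^ 2 * Sm.det ^ ((1 : ℝ) / (n : ℝ)) * Sw.det ^ ((1 : ℝ) / (n : ℝ)) /
            Sw.trace ^ 2)) ∧
      ((∃ P : ℝ, 0 < P ∧ GaussianSignaling.encoderCostLowerBound a b ρ Sm Sw P <
          GaussianSignaling.encoderCostLowerBound a b ρ Sm Sw 0) ↔
        ρ < (2 * a - 1) *
          ((n : ℝ) ^ 2 * Sm.det ^ ((1 : ℝ) / (n : ℝ)) * Sw.det ^ ((1 : ℝ) / (n : ℝ)) /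
            Sw.trace ^ 2))) := by
  have : Nonempty (Fin n) := ⟨⟨0, hn⟩⟩
  have hT := hSw.trace_pos
  refine ⟨?_, fun h ↦ ⟨isStackelbergEquilibrium_zero hSm.posSemidef h b hρ, fun ge gd hE ↦ ?_⟩,
    fun h ↦ ⟨fun ge gd P hge hgd hP hPow ↦
      encoderCostLowerBound_le_encoderCost hn hSm hSw h b hρ hge hgd hP hPow, ?_⟩⟩
  · rw [costKernel, Matrix.transpose_smul, Matrix.transpose_one]
    module
  · have h0 := hE.signal_estimate_eq_zero hSm.posSemidef h hρ
    refine ⟨h0, ?_, not_isInformative_of_signal_eq_zero (h0.mono fun p hp ↦ hp.1)⟩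
    rw [IsNonInformative, integral_source]
    exact h0.mono fun p hp ↦ hp.2
  · have hc : 0 < (2 * a - 1) * kappa Sm Sw :=
      mul_pos (by linarith) (kappa_pos hn hSm hSw)
    refine ⟨⟨?_, fun hlt ↦ ?_⟩, ⟨?_, fun hlt ↦ ?_⟩⟩
    · rintro ⟨P, hP, hmin⟩
      exact lt_threshold_of_le hc hT hP (hmin (Set.mem_Ici.2 le_rfl))
    · obtain ⟨P, hP, hmin, -⟩ := exists_isMinOn_of_lt_threshold (b := b) hρ hc hT hlt
      exact ⟨P, hP, hmin⟩
    · rintro ⟨P, hP, hlt⟩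
      exact lt_threshold_of_le hc hT hP hlt.le
    · obtain ⟨P, hP, -, hlt⟩ := exists_isMinOn_of_lt_threshold (b := b) hρ hc hT hlt
      exact ⟨P, hP, hlt⟩
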